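/- Let $p$ be a prime and let $R$ be an $F$-finite regular domain of characteristic $p$; that is, $R$ is a Noetherian integral domain of characteristic $p$ all of whose localizations at prime ideals are regular local rings, and the Frobenius endomorphism of $R$ is a finite ring homomorphism. Let $\mathfrak a$ be an ideal of $R$. For $q=p^e$ with $e\ge 0$, let $\mathfrak a^{[q]}$ be the ideal generated by all $f^{q}$ with $f\in\mathfrak a$, and let $\mathfrak a^{[1/q]}$ be the smallest ideal $\mathfrak c$ of $R$ such that $\mathfrak a\subseteq\mathfrak c^{[q]}$. For an integer $k\ge 0$ with base $p$ expansion $k=k_0+k_1p+\cdots+k_rp^r$, set $$\mathfrak a^{[k]}=\mathfrak a^{k_0}\,(\mathfrak a^{k_1})^{[p]}\cdots(\mathfrak a^{k_r})^{[p^r]},$$ and for $q=p^e$ set $\mathfrak a^{[k/q]}=(\mathfrak a^{[k]})^{[1/q]}$. For a real number $t\ge 0$ (with $\mathfrak a\neq 0$ or $t>0$), set $$\mathfrak a^{[t]}=\bigcup_{e\ge 0}\mathfrak a^{[\lceil p^e t\rceil/p^e]},$$ the union of an ascending chain of ideals. If $\mathfrak a$ is nonzero and proper, its least critical exponent is $$\operatorname{lce}(\mathfrak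 a)=\sup\{t\in\mathbb R_{>0}:\mathfrak a^{[t]}=R\}.$$ Then, for every nonzero proper ideal $\mathfrak a$ of $R$, for every $q=p^e$ with $e\ge 1$, and for every integer $k$ with $0\le k\le q-1$, $$\operatorname{lce}(\mathfrak a)\notin\left(\frac{k}{q},\,\frac{k}{q-1}\right).$$ -/

import Mathlib

open scoped NNReal ENNReal

namespace FrobeniusPower

variable {R : Type*} [CommRing R]

/-- The Frobenius power `a^[p^e]`: the ideal generated by all `f ^ (p ^ e)` with `f ∈ a`. -/
def frob (p e : ℕ) (a : Ideal R) : Ideal R :=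
  Ideal.span ((fun f : R => f ^ p ^ e) '' (a : Set R))

/-- The integral Frobenius power `a^[k]`: if `k = k₀ + k₁ p + ⋯ + k_r p^r` is the base `p`
expansion of `k`, this is the product of the ideals `(a ^ kᵢ)^[p^i]`. The `i`-th base `p` digit
of `k` is `k / p ^ i % p`, and the digits with `i > Nat.log p k` vanish. -/
def intPow (p k : ℕ) (a : Ideal R) : Ideal R :=
  ∏ i ∈ Finset.range (Nat.log p k + 1), frob p i (a ^ (k / p ^ i % p))

/-- The ideal `a^[1/p^e]`: the smallest ideal `c` such that `a ⊆ c^[p^e]`. (In an `F`-finite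
regular ring the set of such ideals has a smallest element, which is then its infimum.) -/
def root (p e : ℕ) (a : Ideal R) : Ideal R :=
  sInf {c : Ideal R | a ≤ frob p e c}

/-- The `p`-rational Frobenius power `a^[k/p^e] = (a^[k])^[1/p^e]`. -/
def ratPow (p k e : ℕ) (a : Ideal R) : Ideal R :=
  root p e (intPow p k a)

/-- The real Frobenius power `a^[t]`: the union of the ascending chain of the ideals `a^[t_e]`,
where `t_e = ⌈p^e t⌉ / p^e` are the canonical `p`-rational approximations decreasing to `t`. -/
noncomputable def realPow (p : ℕ) (a : Ideal R) (t : ℝ≥0) : Ideal R :=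
  ⨆ e : ℕ, ratPow p ⌈(p : ℝ≥0) ^ e * t⌉₊ e a

/-- The least critical exponent of `a`: the supremum of all real `t > 0` with `a^[t] = R`. The
supremum is taken in `[0, ∞]`, so that it is `∞` for `a = R`. -/
noncomputable def lce (p : ℕ) (a : Ideal R) : ℝ≥0∞ :=
  sSup ((fun t : ℝ≥0 => (t : ℝ≥0∞)) '' {t : ℝ≥0 | 0 < t ∧ realPow p a t = ⊤})

end FrobeniusPower

/-! Write `q = p^e`. If the least critical exponent exceeds `k/q`, then `a^[k/q] = R`. Since `k <
q`, multiplying `k` by `1 + q + ⋯ + q^(n-1)` repeats its block of `e` base `p` digits `n` times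
without carries, so the integral Frobenius power splits into factors `(a^[k])^[q^i]`. Hence `a^[t] =
R` also for `t = k(1 + q + ⋯ + q^(n-1))/q^n`; these `t` tend to `k/(q-1)`, so the exponent is at
least `k/(q-1)`.

The splitting is exploited by `root_add_mul_frob_eq_top`: if `b^[1/q] = R` and `b'^[1/q'] = R`, then
`(b · b'^[q])^[1/(qq')] = R`. Indeed, if `b · b'^[q] ⊆ (c^[q'])^[q]`, then for each `f ∈ b'` the
ideal `b` lies in `(c^[q'] : f)^[q]`, so this colon is `R` and `f ∈ c^[q']`; thus `b' ⊆ c^[q']` and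
`c = R`.

The passage from `f^q b ⊆ c^[q]` to `b ⊆ (c : f)^[q]` is flatness of Frobenius on a regular ring. It
is checked locally: the maximal ideal is generated by a regular sequence, the `q`-th powers of that
sequence are again regular, and the local criterion for flatness applies. -/

section Flatness

/-! ### Local criterion for flatness, phrased as injectivity of `S ⊗ c → S`. -/

open TensorProduct RingTheory.Sequence

variable {A S : Type*} [CommRing A] [CommRing S] [Algebra A S]

/-- If the scalars with values in `c` inject after tensoring with `S` and `x` is a nonzerodivisor
modulo `cS`, then the same holds for `c + (x)`. -/
theorem Ideal.lTensor_subtype_injective_sup_span_singleton {c : Ideal A} {x : A}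
    (hc : Function.Injective (c.subtype.lTensor S))
    (hx : IsSMulRegular (S ⧸ (c • ⊤ : Submodule A S)) x) :
    Function.Injective ((c ⊔ Ideal.span {x}).subtype.lTensor S) := by
  have hxd : x ∈ c ⊔ Ideal.span {x} :=
    Ideal.mem_sup_right (Ideal.mem_span_singleton_self x)
  set d := c ⊔ Ideal.span {x} with hd
  have hcd : c ≤ d := le_sup_left
  let i : c →ₗ[A] d := Submodule.inclusion hcd
  have hi : d.subtype ∘ₗ i = c.subtype := rfl
  let xd : d := ⟨x, hxd⟩
  have key (z : S ⊗[A] d) : ∃ (z' : S ⊗[A] c) (s : S), z = i.lTensor S z' + s ⊗ₜ xd := by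
    induction z with
    | zero => exact ⟨0, 0, by simp⟩
    | add a b ha hb =>
      obtain ⟨z₁, s₁, rfl⟩ := ha
      obtain ⟨z₂, s₂, rfl⟩ := hb
      exact ⟨z₁ + z₂, s₁ + s₂, by rw [map_add, add_tmul]; abel⟩
    | tmul s y =>
      obtain ⟨y, hy⟩ := y
      obtain ⟨u, hu, v, hv, rfl⟩ := Submodule.mem_sup.mp hy
      obtain ⟨r, rfl⟩ := Ideal.mem_span_singleton'.mp hv
      refine ⟨s ⊗ₜ ⟨u, hu⟩, r • s, ?_⟩
      rw [LinearMap.lTensor_tmul, smul_tmul, ← tmul_add]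
      rfl
  have mult (w : S ⊗[A] c) :
      (TensorProduct.rid A S (c.subtype.lTensor S w)) ⊗ₜ[A] xd = x • i.lTensor S w := by
    induction w with
    | zero => simp
    | add a b ha hb => simp [add_tmul, ha, hb]
    | tmul s y =>
      simp only [LinearMap.lTensor_tmul, TensorProduct.rid_tmul, smul_tmul, ← tmul_smul]
      congr 1
      ext
      simp [xd, i, mul_comm]
  have mem_smul (w : S ⊗[A] c) :
      TensorProduct.rid A S (c.subtype.lTensor S w) ∈ (c • ⊤ : Submodule A S) := by
    induction w with
    | zero => simp
    | add a b ha hb => rw [map_add, map_add]; exact add_mem ha hb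
    | tmul s y => simpa using Submodule.smul_mem_smul y.2 (Submodule.mem_top (x := s))
  have range (s : S) (hs : s ∈ (c • ⊤ : Submodule A S)) :
      ∃ w : S ⊗[A] c, TensorProduct.rid A S (c.subtype.lTensor S w) = s := by
    induction hs using Submodule.smul_induction_on' with
    | smul r hr s _ => exact ⟨s ⊗ₜ ⟨r, hr⟩, by simp⟩
    | add a _ b _ ha hb =>
      obtain ⟨w, rfl⟩ := ha
      obtain ⟨w', rfl⟩ := hb
      exact ⟨w + w', by simp⟩
  rw [injective_iff_map_eq_zero]
  intro z hz
  obtain ⟨z', s, rfl⟩ := key z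
  rw [map_add, ← LinearMap.lTensor_comp_apply, hi, LinearMap.lTensor_tmul] at hz
  have hz' := congrArg (TensorProduct.rid A S) hz
  rw [map_add, map_zero, TensorProduct.rid_tmul] at hz'
  -- The vanishing image says `x s ∈ cS`, so `s ∈ cS` by regularity. Then `s ⊗ x` is `x` times an
  -- element coming from `S ⊗ c`, where injectivity is known.
  have hs : s ∈ (c • ⊤ : Submodule A S) := by
    rw [← Submodule.Quotient.mk_eq_zero]
    apply hx.right_eq_zero_of_smul
    rw [← Submodule.Quotient.mk_smul, Submodule.Quotient.mk_eq_zero]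
    have : x • s = -TensorProduct.rid A S (c.subtype.lTensor S z') := by
      rw [eq_neg_iff_add_eq_zero, add_comm]; exact hz'
    rw [this]
    exact neg_mem (mem_smul z')
  obtain ⟨w, rfl⟩ := range s hs
  rw [mult, ← map_smul, ← map_add]
  have : z' + x • w = 0 := by
    apply hc
    apply (TensorProduct.rid A S).injective
    rw [map_zero, map_zero, map_add, map_add, map_smul, map_smul]
    exact hz'
  rw [this, map_zero]

theorem Ideal.lTensor_subtype_ofList_injective {rs : List A} (h : IsWeaklyRegular S rs) :
    Function.Injective ((Ideal.ofList rs).subtype.lTensor S) := by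
  induction rs using List.reverseRecOn with
  | nil =>
    rw [Ideal.ofList_nil]
    intro a b _
    have (z : S ⊗[A] (⊥ : Ideal A)) : z = 0 := by
      induction z with
      | zero => rfl
      | add a b ha hb => rw [ha, hb, add_zero]
      | tmul s y => rw [Subsingleton.elim y 0, tmul_zero]
    rw [this a, this b]
  | append_singleton rs x ih =>
    rw [isWeaklyRegular_append_iff, isWeaklyRegular_singleton_iff] at h
    rw [Ideal.ofList_append, Ideal.ofList_singleton]
    exact Ideal.lTensor_subtype_injective_sup_span_singleton (ih h.1) h.2

/-- Here `m = (c : u)`, and `m → c × A → c + (u)` with `a ↦ (au, -a)` is exact. A kernel element of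
`S ⊗ c` dies in `S ⊗ (c + (u))`, hence lifts to `S ⊗ m`; the second coordinate forces the lift to
vanish in `S`, so it is zero. -/
theorem Ideal.lTensor_subtype_injective_of_sup_span_singleton {m c : Ideal A} {u : A}
    (hm : Function.Injective (m.subtype.lTensor S)) (hmu : ∀ a, a ∈ m ↔ a * u ∈ c)
    (hd : Function.Injective ((c ⊔ Ideal.span {u}).subtype.lTensor S)) :
    Function.Injective (c.subtype.lTensor S) := by
  have hud : u ∈ c ⊔ Ideal.span {u} :=
    Ideal.mem_sup_right (Ideal.mem_span_singleton_self u)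
  set d := c ⊔ Ideal.span {u}
  let i : c →ₗ[A] d := Submodule.inclusion le_sup_left
  let f : m →ₗ[A] c × A :=
    LinearMap.prod (((LinearMap.lsmul A A).flip u).restrict fun a ha ↦ (hmu a).mp ha) (-m.subtype)
  let g : c × A →ₗ[A] d := i.coprod (LinearMap.toSpanSingleton A d ⟨u, hud⟩)
  have hg : Function.Surjective g := by
    rintro ⟨y, hy⟩
    obtain ⟨v, hv, w, hw, rfl⟩ := Submodule.mem_sup.mp hy
    obtain ⟨r, rfl⟩ := Ideal.mem_span_singleton'.mp hw
    exact ⟨(⟨v, hv⟩, r), rfl⟩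
  have hfg : Function.Exact f g := by
    rintro ⟨⟨y, hy⟩, a⟩
    have e : g (⟨y, hy⟩, a) = 0 ↔ y + a * u = 0 := by
      rw [← Subtype.coe_inj]; rfl
    rw [e]
    constructor
    · intro h
      have ha : a * u = -y := by linear_combination h
      refine ⟨⟨-a, (hmu _).mpr ?_⟩, ?_⟩
      · simpa [ha] using hy
      · ext
        · simp [f]; linear_combination -h
        · simp [f]
    · rintro ⟨⟨b, hb⟩, h⟩
      have h1 := congrArg (fun v ↦ (v.1 : A)) h
      have h2 := congrArg Prod.snd h
      simp [f] at h1 h2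
      rw [← h1, ← h2]; ring
  rw [injective_iff_map_eq_zero]
  intro z hz
  have hz₀ : i.lTensor S z = 0 := by
    apply hd
    rw [map_zero, ← LinearMap.lTensor_comp_apply]
    exact hz
  have hz₁ : g.lTensor S ((LinearMap.inl A c A).lTensor S z) = 0 := by
    rw [← LinearMap.lTensor_comp_apply, LinearMap.coprod_inl, hz₀]
  obtain ⟨w, hw⟩ := (lTensor_exact S hfg hg _).mp hz₁
  have hw0 : w = 0 := by
    apply hm
    have := congrArg ((LinearMap.snd A c A).lTensor S) hw
    rw [← LinearMap.lTensor_comp_apply, ← LinearMap.lTensor_comp_apply, LinearMap.snd_prod,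
      LinearMap.snd_comp_inl, LinearMap.lTensor_zero, LinearMap.lTensor_neg] at this
    rw [map_zero]
    simpa using this
  have := congrArg ((LinearMap.fst A c A).lTensor S) hw
  rw [hw0, map_zero, map_zero, ← LinearMap.lTensor_comp_apply, LinearMap.fst_comp_inl] at this
  simpa using this.symm

/-- Tensor the exact sequence `c ∩ J → c × J → c + J → 0`. With `J` a high power of the maximal
ideal, this pushes the kernel of `S ⊗ c → S` arbitrarily deep. -/
theorem Ideal.mem_range_lTensor_inclusion_inf {c J : Ideal A}
    (h : Function.Injective ((c ⊔ J).subtype.lTensor S)) {z : S ⊗[A] c}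
    (hz : c.subtype.lTensor S z = 0) :
    z ∈ LinearMap.range
      ((Submodule.inclusion (inf_le_left : c ⊓ J ≤ c)).lTensor S) := by
  let i : c →ₗ[A] ↥(c ⊔ J) := Submodule.inclusion le_sup_left
  let j : J →ₗ[A] ↥(c ⊔ J) := Submodule.inclusion le_sup_right
  let f : ↥(c ⊓ J) →ₗ[A] c × J :=
    LinearMap.prod (Submodule.inclusion inf_le_left) (-Submodule.inclusion inf_le_right)
  let g : c × J →ₗ[A] ↥(c ⊔ J) := i.coprod j
  have hg : Function.Surjective g := by
    rintro ⟨y, hy⟩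
    obtain ⟨v, hv, w, hw, rfl⟩ := Submodule.mem_sup.mp hy
    exact ⟨(⟨v, hv⟩, ⟨w, hw⟩), rfl⟩
  have hfg : Function.Exact f g := by
    rintro ⟨⟨y, hy⟩, ⟨a, ha⟩⟩
    have e : g (⟨y, hy⟩, ⟨a, ha⟩) = 0 ↔ y + a = 0 := by
      rw [← Subtype.coe_inj]; rfl
    rw [e]
    constructor
    · intro h
      have hya : y = -a := by linear_combination h
      refine ⟨⟨y, hy, ?_⟩, ?_⟩
      · rw [hya]; exact neg_mem ha
      · ext
        · simp [f]
        · simp [f, hya]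
    · rintro ⟨⟨b, hb⟩, h⟩
      have h1 := congrArg (fun v ↦ (v.1 : A)) h
      have h2 := congrArg (fun v ↦ (v.2 : A)) h
      simp [f] at h1 h2
      rw [← h1, ← h2]; ring
  have hz₁ : g.lTensor S ((LinearMap.inl A c J).lTensor S z) = 0 := by
    rw [← LinearMap.lTensor_comp_apply, LinearMap.coprod_inl]
    apply h
    rw [map_zero, ← LinearMap.lTensor_comp_apply]
    exact hz
  obtain ⟨w, hw⟩ := (lTensor_exact S hfg hg _).mp hz₁
  refine ⟨w, ?_⟩
  have := congrArg ((LinearMap.fst A c J).lTensor S) hw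
  rw [← LinearMap.lTensor_comp_apply, ← LinearMap.lTensor_comp_apply, LinearMap.fst_comp_inl,
    LinearMap.fst_prod] at this
  simpa using this

open IsLocalRing

/-- Noetherian induction from above: a proper such `c` has a socle element `u ∉ c` with `(c : u)`
maximal, and the claim descends from `c + (u)` to `c`. -/
theorem Ideal.lTensor_subtype_injective_of_pow_le [IsLocalRing A] [IsNoetherianRing A]
    (hm : Function.Injective ((maximalIdeal A).subtype.lTensor S)) {n : ℕ} {c : Ideal A}
    (hc : maximalIdeal A ^ n ≤ c) : Function.Injective (c.subtype.lTensor S) := by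
  induction c using IsNoetherian.induction with
  | hgt c ih =>
    by_cases htop : c = ⊤
    · subst htop
      exact (LinearEquiv.lTensor S (Submodule.topEquiv (R := A) (M := A))).injective
    obtain ⟨k, hk, hk'⟩ : ∃ k, ¬ maximalIdeal A ^ k ≤ c ∧ maximalIdeal A ^ (k + 1) ≤ c := by
      by_contra! H
      have : ∀ k, ¬ maximalIdeal A ^ k ≤ c := by
        intro k
        induction k with
        | zero => simpa using htop
        | succ k ih => exact H k ih
      exact this n hc
    obtain ⟨u, hu, huc⟩ := Set.not_subset.mp hk
    refine Ideal.lTensor_subtype_injective_of_sup_span_singleton (u := u) hm (fun a ↦ ⟨fun ha ↦ ?_,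
      fun ha ↦ ?_⟩) (ih _ ?_ (hc.trans le_sup_left))
    · apply hk'
      rw [pow_succ']
      exact Ideal.mul_mem_mul ha hu
    · rw [mem_maximalIdeal, mem_nonunits_iff]
      intro hunit
      exact huc ((Ideal.unit_mul_mem_iff_mem c hunit).mp ha)
    · exact left_lt_sup.mpr fun h ↦ huc (h (Ideal.mem_span_singleton_self u))

/-- A version of the local criterion for flatness. -/
theorem Module.Flat.of_lTensor_maximalIdeal_injective [IsLocalRing A] [IsNoetherianRing A]
    [IsNoetherianRing S]
    (hS : (maximalIdeal A).map (algebraMap A S) ≤ Ideal.jacobson ⊥)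
    (hm : Function.Injective ((maximalIdeal A).subtype.lTensor S)) : Module.Flat A S := by
  rw [Module.Flat.iff_lTensor_injective']
  intro c
  rw [injective_iff_map_eq_zero]
  intro z hz
  set n := (maximalIdeal A).map (algebraMap A S)
  have hmem (j : ℕ) : z ∈ (n ^ j • ⊤ : Submodule S (S ⊗[A] c)) := by
    obtain ⟨k, hk⟩ := (maximalIdeal A).exists_pow_inf_eq_pow_smul c
    -- Artin–Rees puts `z` in `n^j (S ⊗ c)` for every `j`; Krull's intersection theorem then gives
    -- `z = 0`.
    have hle : c ⊓ maximalIdeal A ^ (j + k) ≤ maximalIdeal A ^ j • c := by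
      have := hk (j + k) (Nat.le_add_left k j)
      rw [Nat.add_sub_cancel, Ideal.smul_top_eq_map, Algebra.algebraMap_self, Ideal.map_id] at this
      rw [inf_comm]
      exact this.le.trans (Submodule.smul_mono le_rfl inf_le_right)
    obtain ⟨w, rfl⟩ := Ideal.mem_range_lTensor_inclusion_inf (J := maximalIdeal A ^ (j + k))
      (Ideal.lTensor_subtype_injective_of_pow_le hm (n := j + k) le_sup_right) hz
    clear hz
    induction w with
    | zero => simp
    | add a b ha hb => rw [map_add]; exact add_mem ha hb
    | tmul s y =>
      rw [LinearMap.lTensor_tmul]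
      have hy : ∀ y' (hy' : y' ∈ maximalIdeal A ^ j • c),
          s ⊗ₜ[A] (⟨y', Submodule.smul_le_right hy'⟩ : c) ∈
            (n ^ j • ⊤ : Submodule S (S ⊗[A] c)) := by
        intro y' hy'
        induction hy' using Submodule.smul_induction_on' with
        | smul r hr v hv =>
          have : s ⊗ₜ[A] (⟨r • v, Submodule.smul_le_right (Submodule.smul_mem_smul hr hv)⟩ : c) =
              (algebraMap A S r) • (s ⊗ₜ[A] (⟨v, hv⟩ : c)) := by
            rw [algebraMap_smul, ← tmul_smul]; rfl
          rw [this]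
          refine Submodule.smul_mem_smul ?_ trivial
          rw [← Ideal.map_pow]
          exact Ideal.mem_map_of_mem _ hr
        | add a ha b hb iha ihb =>
          have := add_mem iha ihb
          rw [← tmul_add] at this
          exact this
      exact hy y.1 (hle y.2)
  have : z ∈ (⨅ j : ℕ, n ^ j • ⊤ : Submodule S (S ⊗[A] c)) := by
    simpa using hmem
  rw [Ideal.iInf_pow_smul_eq_bot_of_le_jacobson _ hS] at this
  simpa using this

end Flatness

section RegularLocal

/-! ### Regular local rings: domains with regular sequences of parameters. -/

open IsLocalRing RingTheory.Sequence Pointwise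

/-- Prime avoidance tolerates the non-prime ideal `m²`. If `m ⊆ m²`, Nakayama gives `m = 0`, which
would be a minimal prime. -/
theorem IsLocalRing.exists_notMem_sq_notMem_minimalPrimes (A : Type*) [CommRing A] [IsLocalRing A]
    [IsNoetherianRing A] (h : maximalIdeal A ∉ minimalPrimes A) :
    ∃ x ∈ maximalIdeal A, x ∉ maximalIdeal A ^ 2 ∧ ∀ P ∈ minimalPrimes A, x ∉ P := by
  by_contra! H
  have hfin := minimalPrimes.finite_of_isNoetherianRing A
  have hsub : (maximalIdeal A : Set A) ⊆
      ⋃ P ∈ insert (maximalIdeal A ^ 2) (minimalPrimes A), (P : Set A) := by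
    intro x hx
    by_cases hx2 : x ∈ maximalIdeal A ^ 2
    · exact Set.mem_biUnion (Set.mem_insert _ _) hx2
    · obtain ⟨P, hP, hxP⟩ := H x hx hx2
      exact Set.mem_biUnion (Set.mem_insert_of_mem _ hP) hxP
  obtain ⟨P, hP, hle⟩ := (Ideal.subset_union_prime_finite (f := id) (hfin.insert _)
    (maximalIdeal A ^ 2) (maximalIdeal A ^ 2) (by
      rintro P (rfl | hP) h1 _
      · exact absurd rfl h1
      · exact hP.1.1)).mp hsub
  rcases hP with rfl | hP
  · have hbot : maximalIdeal A = ⊥ := by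
      refine Submodule.eq_bot_of_le_smul_of_le_jacobson_bot (maximalIdeal A) _
        (IsNoetherian.noetherian _) ?_ (maximalIdeal_le_jacobson _)
      simpa [sq] using hle
    apply h
    exact ⟨⟨inferInstance, bot_le⟩, fun _ _ _ ↦ hbot ▸ bot_le⟩
  · apply h
    have : P = maximalIdeal A := le_antisymm (le_maximalIdeal hP.1.1.ne_top) hle
    rwa [← this]

/-- Since `x ∉ m²`, some coefficient of `x` on a minimal generating set is a unit, and that
generator can be exchanged for `x`. -/
theorem IsLocalRing.exists_finset_span_insert_eq_maximalIdeal {A : Type*} [CommRing A]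
    [IsLocalRing A] [IsNoetherianRing A] {x : A} (hx : x ∈ maximalIdeal A)
    (hx2 : x ∉ maximalIdeal A ^ 2) :
    ∃ T : Finset A, T.card + 1 = (maximalIdeal A).spanFinrank ∧
      Ideal.span (insert x (T : Set A)) = maximalIdeal A := by
  classical
  obtain ⟨s, hcard, hs⟩ := (IsNoetherian.noetherian
    (maximalIdeal A)).exists_span_finset_card_eq_spanFinrank
  change Ideal.span (s : Set A) = _ at hs
  rw [← hs] at hx
  obtain ⟨a, ha⟩ := (Submodule.mem_span_finset (R := A)).mp hx |>.imp fun _ h ↦ h.2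
  obtain ⟨i, hi, hai⟩ : ∃ i ∈ s, IsUnit (a i) := by
    by_contra! H
    apply hx2
    rw [← ha, sq]
    refine sum_mem fun i hi ↦ Ideal.mul_mem_mul (H i hi) ?_
    rw [← hs]
    exact Ideal.subset_span hi
  refine ⟨s.erase i, ?_, le_antisymm ?_ ?_⟩
  · rw [Finset.card_erase_add_one hi, hcard]
  · rw [← hs, Ideal.span_le, Set.insert_subset_iff]
    exact ⟨hx, fun y hy ↦ Ideal.subset_span (Finset.mem_of_mem_erase hy)⟩
  · conv_lhs => rw [← hs]
    rw [Ideal.span_le]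
    have hmem : ∀ y ∈ s.erase i, y ∈ Ideal.span (insert x (s.erase i : Set A)) :=
      fun y hy ↦ Ideal.subset_span (Set.mem_insert_of_mem _ hy)
    intro y hy
    by_cases hyi : y = i
    · subst hyi
      rw [SetLike.mem_coe, ← Ideal.unit_mul_mem_iff_mem _ hai]
      have : a y * y = x - ∑ j ∈ s.erase y, a j * j := by
        rw [← ha, ← Finset.add_sum_erase s _ hi]
        simp
      rw [this]
      exact sub_mem (Ideal.subset_span (Set.mem_insert _ _))
        (sum_mem fun j hj ↦ Ideal.mul_mem_left _ _ (hmem j hj))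
    · exact hmem y (Finset.mem_erase.mpr ⟨hyi, hy⟩)

/-- A minimal prime `P ⊆ (x)` not containing `x` satisfies `P = xP`, so `P = 0` by Nakayama. -/
theorem IsLocalRing.isDomain_of_isPrime_span_singleton {A : Type*} [CommRing A]
    [IsLocalRing A] [IsNoetherianRing A] {x : A} (hx : x ∈ maximalIdeal A)
    (hprime : (Ideal.span {x}).IsPrime) (hmin : ∀ P ∈ minimalPrimes A, x ∉ P) : IsDomain A := by
  obtain ⟨P, hP, hPx⟩ := Ideal.exists_minimalPrimes_le (I := ⊥) (J := Ideal.span {x}) bot_le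
  have hPp : P.IsPrime := hP.1.1
  have hbot : P = ⊥ := by
    refine Submodule.eq_bot_of_le_smul_of_le_jacobson_bot (maximalIdeal A) _
        (IsNoetherian.noetherian _) ?_ (maximalIdeal_le_jacobson _)
    intro y hy
    obtain ⟨z, rfl⟩ := Ideal.mem_span_singleton'.mp (hPx hy)
    have hz : z ∈ P := (hPp.mem_or_mem hy).resolve_right (hmin P hP)
    rw [mul_comm]
    exact Submodule.smul_mem_smul hx hz
  subst hbot
  exact IsDomain.of_bot_isPrime A

/-- A regular local ring is a domain whose maximal ideal is generated by a weakly regular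
sequence. -/
theorem IsRegularLocalRing.isDomain_and_exists_isWeaklyRegular (n : ℕ) (A : Type*) [CommRing A]
    [IsRegularLocalRing A] (hn : (maximalIdeal A).spanFinrank = n) :
    IsDomain A ∧ ∃ rs : List A, Ideal.ofList rs = maximalIdeal A ∧ IsWeaklyRegular A rs := by
  induction n generalizing A with
  | zero =>
    rw [Submodule.spanFinrank_eq_zero_iff_eq_bot (IsNoetherian.noetherian _)] at hn
    refine ⟨?_, [], by rw [Ideal.ofList_nil, hn], IsWeaklyRegular.nil A A⟩
    exact (IsLocalRing.isField_iff_maximalIdeal_eq.mpr hn).isDomain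
  | succ n ih =>
    have hdim : ringKrullDim A = (n + 1 : ℕ) := by
      rw [← IsRegularLocalRing.spanFinrank_maximalIdeal, hn]
    have hmin : maximalIdeal A ∉ minimalPrimes A := by
      intro h
      have h0 := Ideal.height_eq_zero_iff.mpr h
      have := maximalIdeal_height_eq_ringKrullDim (R := A)
      rw [h0, hdim] at this
      norm_cast at this
    obtain ⟨x, hx, hx2, hxmin⟩ := exists_notMem_sq_notMem_minimalPrimes A hmin
    obtain ⟨T, hT, hspan⟩ := exists_finset_span_insert_eq_maximalIdeal hx hx2
    have hnt : Nontrivial (A ⧸ Ideal.span {x}) := Ideal.Quotient.nontrivial_iff.mpr fun h ↦ by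
      rw [Ideal.span_singleton_eq_top] at h
      exact hx h
    let π := Ideal.Quotient.mk (Ideal.span {x})
    have hπ : Function.Surjective π := Ideal.Quotient.mk_surjective
    have : IsLocalRing (A ⧸ Ideal.span {x}) := IsLocalRing.of_surjective' π hπ
    have hmax : (maximalIdeal A).map π = maximalIdeal (A ⧸ Ideal.span {x}) :=
      IsLocalRing.map_maximalIdeal_of_surjective π hπ
    have hle : (maximalIdeal (A ⧸ Ideal.span {x})).spanFinrank ≤ n := by
      classical
      have : maximalIdeal (A ⧸ Ideal.span {x}) = Ideal.span (T.image π : Set _) := by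
        rw [← hmax, ← hspan, Ideal.map_span, Set.image_insert_eq, Finset.coe_image,
          show π x = 0 from Ideal.Quotient.eq_zero_iff_mem.mpr (Ideal.mem_span_singleton_self x)]
        exact Submodule.span_insert_zero
      rw [this]
      refine (Submodule.spanFinrank_span_le_ncard_of_finite (Finset.finite_toSet _)).trans ?_
      rw [Set.ncard_coe_finset]
      exact Finset.card_image_le.trans (by omega)
    -- Killing one element lowers the dimension by at most one, while the number of generators of
    -- the maximal ideal has dropped; so the quotient is again regular.
    have hge : (n : WithBot ℕ∞) ≤ ringKrullDim (A ⧸ Ideal.span {x}) := by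
      have := ringKrullDim_le_ringKrullDim_quotient_add_card (R := A) (s := {x}) (by
        rw [ringJacobson_eq_maximalIdeal]; simpa using hx)
      rw [hdim] at this
      rw [Finset.coe_singleton, Finset.card_singleton, Nat.cast_add] at this
      exact ENat.WithBot.add_le_add_natCast_right_iff.mp this
    have hreg : IsRegularLocalRing (A ⧸ Ideal.span {x}) :=
      IsRegularLocalRing.of_spanFinrank_maximalIdeal_le _ (le_trans (by exact_mod_cast hle) hge)
    have hn' : (maximalIdeal (A ⧸ Ideal.span {x})).spanFinrank = n := by
      refine le_antisymm hle ?_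
      rw [← hreg.spanFinrank_maximalIdeal] at hge
      exact_mod_cast hge
    obtain ⟨hdom, rs', hrs', hw⟩ := ih (A ⧸ Ideal.span {x}) hn'
    have hA : IsDomain A := isDomain_of_isPrime_span_singleton hx
      ((Ideal.Quotient.isDomain_iff_prime _).mp hdom) hxmin
    obtain ⟨rs, rfl⟩ := (List.map_surjective_iff.mpr hπ) rs'
    refine ⟨hA, x :: rs, ?_, ?_⟩
    · rw [← Ideal.map_ofList, ← hmax, Ideal.map_eq_iff_sup_ker_eq_of_surjective π hπ,
        Ideal.mk_ker, sup_eq_left.mpr ((Ideal.span_singleton_le_iff_mem _).mpr hx)] at hrs'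
      rw [Ideal.ofList_cons, sup_comm, hrs']
    · have hx0 : x ≠ 0 := fun h ↦ hx2 (h ▸ zero_mem _)
      rw [isWeaklyRegular_cons_iff]
      refine ⟨IsSMulRegular.of_ne_zero hx0, ?_⟩
      have e : (Ideal.span {x} : Submodule A A) = x • (⊤ : Submodule A A) := by
        rw [← Submodule.ideal_span_singleton_smul, smul_eq_mul, Ideal.mul_top]
      rw [← (Submodule.quotEquivOfEq _ _ e).isWeaklyRegular_congr,
        ← isWeaklyRegular_map_algebraMap_iff (A ⧸ Ideal.span {x})]
      exact hw

theorem RingTheory.Sequence.IsWeaklyRegular.map_pow {A M : Type*} [CommRing A] [IsLocalRing A]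
    [AddCommGroup M] [Module A M] [IsNoetherian A M] (q : ℕ) {rs : List A}
    (h : IsWeaklyRegular M rs) (hq : q ≠ 0) (hrs : ∀ r ∈ rs, r ∈ maximalIdeal A) :
    IsWeaklyRegular M (rs.map (· ^ q)) := by
  -- Regular sequences in the maximal ideal may be permuted, and the last entry may be replaced by a
  -- power. The tail `t` holds entries already treated.
  suffices H : ∀ (l t : List A), (∀ r ∈ l, r ∈ maximalIdeal A) → (∀ r ∈ t, r ∈ maximalIdeal A) →
      IsWeaklyRegular M (l ++ t) → IsWeaklyRegular M (l.map (· ^ q) ++ t) by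
    simpa using H rs [] hrs (by simp) (by simpa using h)
  intro l
  induction l with
  | nil => simp
  | cons x l ih =>
    intro t hl ht h
    simp only [List.mem_cons, forall_eq_or_imp] at hl
    have hxq : x ^ q ∈ maximalIdeal A := Ideal.pow_mem_of_mem _ hl.1 q (Nat.pos_of_ne_zero hq)
    have h1 : IsWeaklyRegular M ((l ++ t) ++ [x]) :=
      isWeaklyRegular_of_perm_of_subset_maximalIdeal h
        (by simpa using List.perm_append_comm (l₁ := [x]) (l₂ := l ++ t))
        (by simp only [List.cons_append, List.mem_cons, List.mem_append]; grind)
    have h2 : IsWeaklyRegular M ((l ++ t) ++ [x ^ q]) := by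
      rw [isWeaklyRegular_append_iff, isWeaklyRegular_singleton_iff] at h1 ⊢
      exact ⟨h1.1, h1.2.pow q⟩
    rw [List.append_assoc] at h2
    have h3 := ih (t ++ [x ^ q]) hl.2 (by simp only [List.mem_append, List.mem_singleton]; grind) h2
    refine isWeaklyRegular_of_perm_of_subset_maximalIdeal h3 ?_ ?_
    · rw [← List.append_assoc]
      simpa using List.perm_append_comm (l₁ := l.map (· ^ q) ++ t) (l₂ := [x ^ q])
    · intro r hr
      simp only [List.mem_append, List.mem_map, List.mem_singleton] at hr
      rcases hr with ⟨a, ha, rfl⟩ | hr | rfl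
      · exact Ideal.pow_mem_of_mem _ (hl.2 a ha) q (Nat.pos_of_ne_zero hq)
      · exact ht r hr
      · exact hxq

end RegularLocal

section FrobeniusFlat

/-! ### Flatness of Frobenius and its compatibility with colon ideals. -/

open IsLocalRing RingTheory.Sequence

/-- By the equational criterion, the relation `f g - ∑ yᵢ sᵢ = 0` is trivial: `g` is a combination
of coefficients `a` with `f a ∈ c`. -/
theorem Module.Flat.mem_map_colon {A S : Type*} [CommRing A] [CommRing S] [Algebra A S]
    [Module.Flat A S] {c : Ideal A} {f : A} {g : S}
    (h : algebraMap A S f * g ∈ c.map (algebraMap A S)) :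
    g ∈ (c.colon {f}).map (algebraMap A S) := by
  obtain ⟨n, s, y, hsum⟩ := Submodule.mem_span_set'.mp h
  have hy (i : Fin n) : ∃ r ∈ c, algebraMap A S r = y i := (y i).2
  choose y' hy' hφy using hy
  let F : Option (Fin n) → A := fun i ↦ i.elim f fun j ↦ -y' j
  let G : Option (Fin n) → S := fun i ↦ i.elim g s
  have hrel : ∑ i, F i • G i = 0 := by
    rw [Fintype.sum_option]
    simp only [F, G, Option.elim, Algebra.smul_def]
    rw [← hsum, ← Finset.sum_add_distrib]
    refine Finset.sum_eq_zero fun i _ ↦ ?_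
    rw [map_neg, hφy, smul_eq_mul]
    ring
  obtain ⟨k, a, z, hz, ha⟩ := Module.Flat.isTrivialRelation_of_sum_smul_eq_zero (R := A) (M := S)
    (f := F) (x := G) hrel
  have hg : g = ∑ j, a none j • z j := hz none
  rw [hg]
  refine sum_mem fun j _ ↦ ?_
  rw [Algebra.smul_def]
  refine Ideal.mul_mem_right _ _ (Ideal.mem_map_of_mem _ ?_)
  rw [Submodule.mem_colon_singleton, smul_eq_mul, mul_comm]
  have := ha j
  rw [Fintype.sum_option] at this
  simp only [F, Option.elim, neg_mul, Finset.sum_neg_distrib] at this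
  rw [add_neg_eq_zero.mp this]
  exact sum_mem fun i _ ↦ c.mul_mem_right _ (hy' i)

theorem RingHom.Flat.mem_map_colon {A S : Type*} [CommRing A] [CommRing S] {φ : A →+* S}
    (hφ : φ.Flat) {c : Ideal A} {f : A} {g : S} (h : φ f * g ∈ c.map φ) :
    g ∈ (c.colon {f}).map φ :=
  @Module.Flat.mem_map_colon A S _ _ φ.toAlgebra hφ c f g h

/-- The iterates of the Frobenius endomorphism of a regular local ring are flat. -/
theorem IsRegularLocalRing.flat_iterateFrobenius (A : Type*) [CommRing A] [IsRegularLocalRing A]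
    (p e : ℕ) [Fact p.Prime] [CharP A p] : (iterateFrobenius A p e).Flat := by
  obtain ⟨-, rs, hrs, hw⟩ := IsRegularLocalRing.isDomain_and_exists_isWeaklyRegular _ A rfl
  have hmem : ∀ r ∈ rs, r ∈ maximalIdeal A := fun r hr ↦ hrs ▸ Ideal.subset_span hr
  have hq : p ^ e ≠ 0 := pow_ne_zero e (Nat.Prime.ne_zero Fact.out)
  have hw' := hw.map_pow (p ^ e) hq hmem
  -- An abstract `S` keeps the Frobenius algebra structure on `A` apart from the identity one.
  have aux (S : Type _) [CommRing S] [IsNoetherianRing S] [Algebra A S]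
      (h1 : (maximalIdeal A).map (algebraMap A S) ≤ Ideal.jacobson ⊥)
      (h2 : IsWeaklyRegular S (rs.map (algebraMap A S))) : Module.Flat A S := by
    refine Module.Flat.of_lTensor_maximalIdeal_injective h1 ?_
    rw [← hrs]
    exact Ideal.lTensor_subtype_ofList_injective ((isWeaklyRegular_map_algebraMap_iff S S rs).mp h2)
  refine @aux A _ _ (iterateFrobenius A p e).toAlgebra ?_ hw'
  refine le_trans ?_ (maximalIdeal_le_jacobson _)
  rw [Ideal.map_le_iff_le_comap]
  exact fun x hx ↦ Ideal.pow_mem_of_mem _ hx _ (Nat.pos_of_ne_zero hq)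

theorem IsLocalization.colon_map_le {R S : Type*} [CommRing R] [CommRing S] [Algebra R S]
    (M : Submonoid R) [IsLocalization M S] (c : Ideal R) (f : R) :
    (c.map (algebraMap R S)).colon {algebraMap R S f} ≤ (c.colon {f}).map (algebraMap R S) := by
  intro x hx
  obtain ⟨r, s, rfl⟩ := IsLocalization.exists_mk'_eq M x
  rw [Submodule.mem_colon_singleton, smul_eq_mul] at hx
  have h : algebraMap R S (r * f) ∈ c.map (algebraMap R S) := by
    rw [map_mul, ← IsLocalization.mk'_spec' S r s, mul_assoc]
    exact Ideal.mul_mem_left _ _ hx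
  obtain ⟨m, hm, hmc⟩ := (IsLocalization.algebraMap_mem_map_algebraMap_iff M S _ _).mp h
  rw [IsLocalization.mk'_mem_map_algebraMap_iff]
  refine ⟨m, hm, ?_⟩
  rwa [Submodule.mem_colon_singleton, smul_eq_mul, mul_assoc]

/-- Membership is local, Frobenius commutes with localization, and so does the colon by one element.
-/
theorem IsRegularRing.mem_map_iterateFrobenius_colon {R : Type*} [CommRing R] [IsRegularRing R]
    (p e : ℕ) [Fact p.Prime] [CharP R p] {c : Ideal R} {f g : R}
    (h : f ^ p ^ e * g ∈ c.map (iterateFrobenius R p e)) :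
    g ∈ (c.colon {f}).map (iterateFrobenius R p e) := by
  refine Ideal.mem_of_localization_maximal fun P hP ↦ ?_
  set L := Localization.AtPrime P
  have : CharP L p := by
    rw [CharP.charP_iff_prime_eq_zero Fact.out, ← map_natCast (algebraMap R L),
      CharP.cast_eq_zero, map_zero]
  have hcomm : (algebraMap R L).comp (iterateFrobenius R p e) =
      (iterateFrobenius L p e).comp (algebraMap R L) :=
    RingHom.iterateFrobenius_comm _ _ _
  have hloc := Ideal.mem_map_of_mem (algebraMap R L) h
  rw [Ideal.map_map, hcomm, ← Ideal.map_map, map_mul, map_pow] at hloc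
  rw [Ideal.map_map, hcomm, ← Ideal.map_map]
  exact Ideal.map_mono (IsLocalization.colon_map_le P.primeCompl c f)
    ((IsRegularLocalRing.flat_iterateFrobenius L p e).mem_map_colon hloc)

end FrobeniusFlat

namespace FrobeniusPower

/-! ### Digit arithmetic of integral Frobenius powers. -/

section Basic

variable {R : Type*} [CommRing R] (p : ℕ)

theorem root_eq_top_iff {e : ℕ} {a : Ideal R} :
    root p e a = ⊤ ↔ ∀ c : Ideal R, a ≤ frob p e c → c = ⊤ :=
  sInf_eq_top

theorem frob_zero (a : Ideal R) : frob p 0 a = a := by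
  simp [frob]

theorem pow_mem_frob (e : ℕ) {a : Ideal R} {f : R} (hf : f ∈ a) : f ^ p ^ e ∈ frob p e a :=
  Ideal.subset_span ⟨f, hf, rfl⟩

theorem frob_one_le_pow (a : Ideal R) : frob p 1 a ≤ a ^ p := by
  refine Ideal.span_le.mpr ?_
  rintro _ ⟨f, hf, rfl⟩
  simpa using Ideal.pow_mem_pow hf p

theorem intPow_zero (a : Ideal R) : intPow p 0 a = ⊤ := by
  simp [intPow, frob_zero]

variable [Fact p.Prime] [CharP R p]

theorem frob_eq_map (e : ℕ) (a : Ideal R) : frob p e a = a.map (iterateFrobenius R p e) :=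
  rfl

theorem frob_mul (e : ℕ) (a b : Ideal R) : frob p e (a * b) = frob p e a * frob p e b := by
  simp only [frob_eq_map, Ideal.map_mul]

theorem frob_top (e : ℕ) : frob p e (⊤ : Ideal R) = ⊤ := by
  rw [frob_eq_map, Ideal.map_top]

theorem frob_mono (e : ℕ) {a b : Ideal R} (h : a ≤ b) : frob p e a ≤ frob p e b := by
  rw [frob_eq_map, frob_eq_map]
  exact Ideal.map_mono h

theorem frob_frob (e₁ e₂ : ℕ) (a : Ideal R) : frob p e₁ (frob p e₂ a) = frob p (e₁ + e₂) a := by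
  rw [frob_eq_map, frob_eq_map, frob_eq_map, Ideal.map_map, iterateFrobenius_add]

theorem intPow_eq_pow_mul_frob (k : ℕ) (a : Ideal R) :
    intPow p k a = a ^ (k % p) * frob p 1 (intPow p (k / p) a) := by
  have hp : 1 < p := Nat.Prime.one_lt Fact.out
  rcases lt_or_ge k p with h | h
  · rw [Nat.div_eq_of_lt h, intPow_zero, frob_top, Ideal.mul_top, intPow, Nat.log_of_lt h]
    simp [frob_zero]
  · rw [intPow, Nat.log_of_one_lt_of_le hp h, Finset.prod_range_succ', mul_comm]
    congr 1
    · simp [frob_zero]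
    · rw [intPow, frob_eq_map, ← Ideal.mapHom_apply, map_prod]
      refine Finset.prod_congr rfl fun i _ ↦ ?_
      rw [Ideal.mapHom_apply, ← frob_eq_map, frob_frob, add_comm 1 i, Nat.div_div_eq_div_mul,
        pow_succ']

/-- As `r < p^e`, the digits of `r` fill the lowest `e` places and those of `m` the places above,
with no carry. -/
theorem intPow_add_pow_mul {e r : ℕ} (hr : r < p ^ e) (m : ℕ) (a : Ideal R) :
    intPow p (r + p ^ e * m) a = intPow p r a * frob p e (intPow p m a) := by
  have hp : 0 < p := Nat.Prime.pos Fact.out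
  induction e generalizing r with
  | zero =>
    obtain rfl : r = 0 := by simpa using hr
    simp [intPow_zero, frob_zero]
  | succ e ih =>
    have hr' : r / p < p ^ e := Nat.div_lt_of_lt_mul (by rwa [pow_succ'] at hr)
    have hmul : r + p ^ (e + 1) * m = r + p * (p ^ e * m) := by ring
    rw [intPow_eq_pow_mul_frob p (r + _), intPow_eq_pow_mul_frob p r, hmul,
      Nat.add_mul_mod_self_left, Nat.add_mul_div_left _ _ hp, ih hr', frob_mul, frob_frob,
      add_comm 1 e, mul_assoc]

theorem intPow_pow_mul (e m : ℕ) (a : Ideal R) :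
    intPow p (p ^ e * m) a = frob p e (intPow p m a) := by
  have := intPow_add_pow_mul p (e := e) (r := 0) (pow_pos (Nat.Prime.pos Fact.out) e) m a
  rwa [zero_add, intPow_zero, Ideal.top_mul] at this

theorem intPow_succ_le (k : ℕ) (a : Ideal R) : intPow p (k + 1) a ≤ a * intPow p k a := by
  have hp : 1 < p := Nat.Prime.one_lt Fact.out
  induction k using Nat.strong_induction_on with
  | _ k ih =>
    rw [intPow_eq_pow_mul_frob p (k + 1), intPow_eq_pow_mul_frob p k, ← mul_assoc, ← pow_succ']
    have hk := Nat.div_add_mod k p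
    have hlt := Nat.mod_lt k (zero_lt_one.trans hp)
    rcases (Nat.succ_le_of_lt hlt).lt_or_eq with h | h
    · have hmod : (k + 1) % p = k % p + 1 := by
        rw [Nat.add_mod, Nat.mod_eq_of_lt hp, Nat.mod_eq_of_lt h]
      have hdiv : (k + 1) / p = k / p := by
        rw [Nat.succ_div_of_not_dvd]
        rw [Nat.dvd_iff_mod_eq_zero, hmod]
        omega
      rw [hmod, hdiv]
    -- The last digit is `p - 1`, so adding one carries; the induction hypothesis at `k / p` and
    -- `a^[p] ⊆ a^p` absorb the carry.
    · have hdvd : k + 1 = p * (k / p + 1) := by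
        rw [mul_add, mul_one]; omega
      have hmod : (k + 1) % p = 0 := by rw [hdvd, Nat.mul_mod_right]
      have hdiv : (k + 1) / p = k / p + 1 := by
        rw [hdvd, Nat.mul_div_cancel_left _ (zero_lt_one.trans hp)]
      rw [hmod, hdiv, pow_zero, Ideal.one_eq_top, Ideal.top_mul, show k % p + 1 = p from h]
      have hkp : intPow p (k / p + 1) a ≤ a * intPow p (k / p) a := by
        rcases Nat.eq_zero_or_pos k with rfl | hpos
        · rw [Nat.zero_mod] at h; omega
        · exact ih _ (Nat.div_lt_self hpos hp)
      exact (frob_mono p 1 hkp).trans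
        ((frob_mul p 1 _ _).le.trans (Ideal.mul_mono_left (frob_one_le_pow p a)))

theorem intPow_antitone (a : Ideal R) : Antitone fun k ↦ intPow p k a :=
  antitone_nat_of_succ_le fun k ↦ (intPow_succ_le p k a).trans Ideal.mul_le_right

theorem ratPow_antitone (e : ℕ) (a : Ideal R) : Antitone fun k ↦ ratPow p k e a :=
  fun _ _ h ↦ sInf_le_sInf fun _ hc ↦ (intPow_antitone p a h).trans hc

end Basic

/-! ### Frobenius roots in regular rings and concatenation of digit blocks. -/

section Regular

variable {R : Type*} [CommRing R] [IsRegularRing R] (p : ℕ) [Fact p.Prime] [CharP R p]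

theorem le_frob_colon {e : ℕ} {b c : Ideal R} {f : R} (h : ∀ g ∈ b, f ^ p ^ e * g ∈ frob p e c) :
    b ≤ frob p e (c.colon {f}) :=
  fun g hg ↦ IsRegularRing.mem_map_iterateFrobenius_colon p e (h g hg)

theorem frob_le_frob_iff {e : ℕ} {b c : Ideal R} : frob p e b ≤ frob p e c ↔ b ≤ c := by
  refine ⟨fun h f hf ↦ ?_, frob_mono p e⟩
  -- For `f ∈ b`, `f^q · 1 ∈ c^[q]` gives `1 ∈ (c : f)^[q] ⊆ (c : f)`.
  have htop : (⊤ : Ideal R) ≤ frob p e (c.colon {f}) :=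
    le_frob_colon p fun g _ ↦ Ideal.mul_mem_right _ _ (h (pow_mem_frob p e hf))
  have hle : frob p e (c.colon {f}) ≤ c.colon {f} := by
    refine Ideal.span_le.mpr ?_
    rintro _ ⟨x, hx, rfl⟩
    exact Ideal.pow_mem_of_mem _ hx _ (pow_pos (Nat.Prime.pos Fact.out) e)
  simpa [Submodule.mem_colon_singleton] using (htop.trans hle) (Submodule.mem_top (x := 1))

theorem root_add_mul_frob_eq_top {e e' : ℕ} {b b' : Ideal R} (h : root p e b = ⊤)
    (h' : root p e' b' = ⊤) : root p (e + e') (b * frob p e b') = ⊤ := by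
  rw [root_eq_top_iff] at *
  intro c hc
  rw [← frob_frob] at hc
  refine h' c fun f hf ↦ ?_
  have htop := h _ (le_frob_colon p (f := f) fun g hg ↦ hc (by
    rw [mul_comm (f ^ p ^ e)]
    exact Ideal.mul_mem_mul hg (pow_mem_frob p e hf)))
  simpa [Submodule.mem_colon_singleton] using htop.ge (Submodule.mem_top (x := 1))

theorem ratPow_pow_mul (d k e : ℕ) (a : Ideal R) :
    ratPow p (p ^ d * k) (d + e) a = ratPow p k e a := by
  simp only [ratPow, root, intPow_pow_mul, ← frob_frob, frob_le_frob_iff]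

theorem monotone_ratPow_ceil (a : Ideal R) (t : ℝ≥0) :
    Monotone fun e : ℕ ↦ ratPow p ⌈(p : ℝ≥0) ^ e * t⌉₊ e a := by
  refine monotone_nat_of_le_succ fun e ↦ ?_
  rw [← ratPow_pow_mul p 1 _ e, add_comm 1 e]
  refine ratPow_antitone p _ a ?_
  rw [Nat.ceil_le, pow_succ', mul_assoc]
  push_cast
  rw [pow_one]
  gcongr
  exact Nat.le_ceil _

theorem ratPow_eq_top_of_realPow_eq_top {k e : ℕ} {a : Ideal R} {t : ℝ≥0}
    (ht : realPow p a t = ⊤) (hk : (k : ℝ≥0) / p ^ e ≤ t) : ratPow p k e a = ⊤ := by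
  have hp : (0 : ℝ≥0) < p := Nat.cast_pos.mpr (Nat.Prime.pos Fact.out)
  -- The chain is ascending, so `1` already lies in some stage `d`, hence in stage `d + e`, where
  -- `k/p^e` can be rewritten as `p^d k / p^(d+e)`.
  have h1 : (1 : R) ∈ realPow p a t := ht ▸ Submodule.mem_top
  have hmono := monotone_ratPow_ceil p a t
  obtain ⟨d, hd⟩ := (Submodule.mem_iSup_of_directed _ hmono.directed_le).mp h1
  have hd' := (Ideal.eq_top_iff_one _).mpr (hmono (Nat.le_add_right d e) hd)
  rw [← ratPow_pow_mul p d k e, eq_top_iff, ← hd']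
  refine ratPow_antitone p _ a (Nat.cast_le.mp (le_trans ?_ (Nat.le_ceil _)))
  · rw [pow_add, mul_assoc]
    push_cast
    gcongr
    rwa [div_le_iff₀ (pow_pos hp e), mul_comm] at hk

theorem ratPow_mul_geom_sum_eq_top {k e : ℕ} {a : Ideal R} (hk : k < p ^ e)
    (h : ratPow p k e a = ⊤) (n : ℕ) :
    ratPow p (k * ∑ i ∈ Finset.range n, (p ^ e) ^ i) (e * n) a = ⊤ := by
  induction n with
  | zero =>
    rw [ratPow, root_eq_top_iff]
    simp [intPow_zero, frob_zero]
  | succ n ih =>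
    have hsum : k * ∑ i ∈ Finset.range (n + 1), (p ^ e) ^ i =
        k + p ^ e * (k * ∑ i ∈ Finset.range n, (p ^ e) ^ i) := by
      rw [geom_sum_succ]; ring
    rw [hsum, mul_add_one, add_comm (e * n), ratPow, intPow_add_pow_mul p hk]
    exact root_add_mul_frob_eq_top p h ih

end Regular

/-- At `t = k/p^e` the ceiling in stage `e` is exactly `k`. Positivity of `k` is needed because the
supremum runs over `t > 0`. -/
theorem div_pow_le_lce {R : Type*} [CommRing R] {p k e : ℕ} {a : Ideal R} (hp : 0 < p)
    (hk : 0 < k) (h : ratPow p k e a = ⊤) : ENNReal.ofReal ((k : ℝ) / (p : ℝ) ^ e) ≤ lce p a := by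
  have hpe : (0 : ℝ≥0) < (p : ℝ≥0) ^ e := pow_pos (Nat.cast_pos.mpr hp) e
  refine le_sSup ⟨(k : ℝ≥0) / (p : ℝ≥0) ^ e, ⟨by positivity, ?_⟩, ?_⟩
  · refine eq_top_iff.mpr (le_iSup_of_le e ?_)
    rw [mul_div_cancel₀ _ hpe.ne', Nat.ceil_natCast, h]
  · change ((_ : ℝ≥0) : ℝ≥0∞) = _
    rw [← ENNReal.ofReal_coe_nnreal]
    simp

end FrobeniusPower

theorem mainTheorem10 {R : Type*} [CommRing R] [IsDomain R] [IsRegularRing R]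
    (p : ℕ) [Fact p.Prime] [CharP R p] (hfin : (frobenius R p).Finite)
    (a : Ideal R) (ha0 : a ≠ ⊥) (ha1 : a ≠ ⊤)
    (e : ℕ) (he : 1 ≤ e) (k : ℕ) (hk : k ≤ p ^ e - 1) :
    FrobeniusPower.lce p a ∉
      Set.Ioo (ENNReal.ofReal ((k : ℝ) / (p : ℝ) ^ e))
        (ENNReal.ofReal ((k : ℝ) / ((p : ℝ) ^ e - 1))) := by
  rintro ⟨hlow, hup⟩
  have hp : 0 < p := Nat.Prime.pos Fact.out
  have hq : 1 < p ^ e := Nat.one_lt_pow (by omega) (Nat.Prime.one_lt Fact.out)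
  have hqr : (1 : ℝ) < (p : ℝ) ^ e := by exact_mod_cast hq
  have hkpos : 0 < k := by
    rcases Nat.eq_zero_or_pos k with rfl | h
    · simp at hup
    · exact h
  obtain ⟨_, ⟨t, ⟨-, ht⟩, rfl⟩, hlt⟩ := lt_sSup_iff.mp hlow
  have hkt : (k : ℝ≥0) / (p : ℝ≥0) ^ e ≤ t := by
    change _ < (t : ℝ≥0∞) at hlt
    rw [← ENNReal.ofReal_coe_nnreal] at hlt
    have := (ENNReal.ofReal_lt_ofReal_iff_of_nonneg (by positivity)).mp hlt
    exact_mod_cast this.le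
  have hrat := FrobeniusPower.ratPow_eq_top_of_realPow_eq_top p ht hkt
  -- The bounds `k(1 + ⋯ + q^(n-1))/q^n = (k/(q-1))(1 - q^(-n))` tend to `k/(q-1)`; `n ≥ 1` makes
  -- the numerators positive.
  refine hup.not_ge (le_of_tendsto (ENNReal.tendsto_ofReal ?_) (Filter.eventually_atTop.mpr
    ⟨1, fun n hn ↦ FrobeniusPower.div_pow_le_lce hp ?_
      (FrobeniusPower.ratPow_mul_geom_sum_eq_top p (by omega) hrat n)⟩))
  · have heq (n : ℕ) : ((k * ∑ i ∈ Finset.range n, (p ^ e) ^ i : ℕ) : ℝ) / (p : ℝ) ^ (e * n) =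
        (k : ℝ) / ((p : ℝ) ^ e - 1) * (1 - (((p : ℝ) ^ e)⁻¹) ^ n) := by
      push_cast
      rw [geom_sum_eq hqr.ne', pow_mul, inv_pow]
      have h1 : (p : ℝ) ^ e - 1 ≠ 0 := (sub_pos.mpr hqr).ne'
      have h2 : ((p : ℝ) ^ e) ^ n ≠ 0 := by positivity
      field_simp
    simp only [heq]
    have := tendsto_pow_atTop_nhds_zero_of_lt_one (inv_nonneg.mpr (zero_le_one.trans hqr.le))
      (inv_lt_one_of_one_lt₀ hqr)
    simpa using (this.const_sub 1).const_mul ((k : ℝ) / ((p : ℝ) ^ e - 1))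
  · refine Nat.mul_pos hkpos (Finset.sum_pos (fun i _ ↦ by positivity) ?_)
    exact Finset.nonempty_range_iff.mpr (by omega)
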